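/- **Theorem ($L_p$-Borell–Brascamp–Lieb inequality).** Let $n\ge 1$ be an integer, $p\in[1,\infty)$, $0\le s<\infty$ and $t\in[0,1]$. For $\lambda\in[0,1]$ put $$a_\lambda=(1-t)^{\frac1p}(1-\lambda)^{\frac{p-1}p},\qquad b_\lambda=t^{\frac1p}\lambda^{\frac{p-1}p}$$ (with $0^0=1$, so that $a_\lambda=1-t$ and $b_\lambda=t$ if $p=1$). Let $f,g,h:\mathbb R^n\to[0,\infty)$ be bounded and Lebesgue integrable, and suppose that $$h(a_\lambda x+b_\lambda y)\;\ge\;\left[a_\lambda f(x)^{\frac1s}+b_\lambda g(y)^{\frac1s}\right]^s$$ for all $x$ with $f(x)>0$, all $y$ with $g(y)>0$ and all $\lambda\in[0,1]$. For $s=0$ the right-hand side is understood as its limit as $s\to0^+$, that is, as the maximum of those of the numbers $f(x)$, $g(y)$ whose coefficient $a_\lambda$, respectively $b_\lambda$, is positive (and as $0$ if $a_\lambda=b_\lambda=0$). Then $$\int_{\mathbb R^n}h\,dx\;\ge\;M^t_{\frac p{n+s}}\left(\int_{\mathbb R^n}f\,dx,\int_{\mathbb R^n}g\,dx\right),$$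 where, for $\alpha>0$ and $a,b\ge0$, $M^t_\alpha(a,b)=\left((1-t)a^\alpha+tb^\alpha\right)^{1/\alpha}$ if $ab>0$ and $M^t_\alpha(a,b)=0$ if $ab=0$. -/

import Mathlib

open MeasureTheory

noncomputable section

namespace LpBBL

/-- The weight `τ^{1/p} σ^{(p-1)/p}`; for `p = 1` the convention `0^0 = 1` is in force,
so that the weight is `τ`. -/
def weight (p τ σ : ℝ) : ℝ :=
  τ ^ (1 / p) * σ ^ ((p - 1) / p)

/-- The combination `[a u^{1/s} + b v^{1/s}]^s` of `u, v ≥ 0` with weights `a, b ≥ 0`.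
For `s = 0` it is understood as the limit `s → 0⁺`, which is the maximum of those of `u`, `v`
whose weight is positive (and `0` if both weights vanish); see `tendsto_comb`. -/
def comb (s a b u v : ℝ) : ℝ :=
  if s = 0 then max (if 0 < a then u else 0) (if 0 < b then v else 0)
  else (a * u ^ (1 / s) + b * v ^ (1 / s)) ^ s

/-- The `α`-mean `M_α^t(a, b)` of `a, b ≥ 0` for a real exponent `α`; it is `0` if `a b = 0`. -/
def mean (α t a b : ℝ) : ℝ :=
  if a * b = 0 then 0
  else if α = 0 then a ^ (1 - t) * b ^ t
  else ((1 - t) * a ^ α + t * b ^ α) ^ (1 / α)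

theorem comb_comm (s a b u v : ℝ) : comb s a b u v = comb s b a v u := by
  unfold comb
  rw [max_comm, add_comm]

theorem mul_rpow_one_div {s b v : ℝ} (hs : 0 < s) (hb : 0 ≤ b) (hv : 0 ≤ v) :
    (b * v ^ (1 / s)) ^ s = b ^ s * v := by
  rw [Real.mul_rpow hb (Real.rpow_nonneg hv _), ← Real.rpow_mul hv, one_div_mul_cancel hs.ne',
    Real.rpow_one]

theorem tendsto_rpow_mul {c v : ℝ} (hc : 0 < c) :
    Filter.Tendsto (fun s : ℝ => c ^ s * v) (nhdsWithin 0 (Set.Ioi 0)) (nhds v) := by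
  have h : Continuous fun s : ℝ => c ^ s * v :=
    (Real.continuous_const_rpow hc.ne').mul continuous_const
  have := h.tendsto 0
  simp only [Real.rpow_zero, one_mul] at this
  exact this.mono_left nhdsWithin_le_nhds

/-- The value of `comb` at `s = 0` is the limit of its values as `s → 0⁺`. -/
theorem tendsto_comb {a b u v : ℝ} (ha : 0 ≤ a) (hb : 0 ≤ b) (hu : 0 ≤ u) (hv : 0 ≤ v) :
    Filter.Tendsto (fun s => comb s a b u v) (nhdsWithin 0 (Set.Ioi 0))
      (nhds (comb 0 a b u v)) := by
  wlog huv : u ≤ v generalizing a b u v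
  · have := this hb ha hv hu (le_of_not_ge huv)
    simpa only [comb_comm _ b a v u] using this
  rcases hb.eq_or_lt with rfl | hb'
  · have e : ∀ s ∈ Set.Ioi (0 : ℝ), a ^ s * u = comb s a 0 u v := by
      intro s hs
      have hs : 0 < s := hs
      simp only [comb, hs.ne', if_false, zero_mul, add_zero]
      exact (mul_rpow_one_div hs ha hu).symm
    rcases ha.eq_or_lt with rfl | ha'
    · refine Filter.Tendsto.congr' (f₁ := fun _ => (0 : ℝ)) ?_ ?_
      · filter_upwards [self_mem_nhdsWithin] with s hs
        rw [← e s hs, Real.zero_rpow (ne_of_gt hs), zero_mul]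
      · simp [comb]
    · refine Filter.Tendsto.congr' (Filter.eventuallyEq_of_mem self_mem_nhdsWithin e) ?_
      simpa [comb, ha', hu] using tendsto_rpow_mul (v := u) ha'
  · have h0 : comb 0 a b u v = v := by
      by_cases h : 0 < a <;> simp [comb, h, hb', huv, hv]
    rw [h0]
    refine tendsto_of_tendsto_of_tendsto_of_le_of_le' (tendsto_rpow_mul (v := v) hb')
      (tendsto_rpow_mul (v := v) (c := a + b) (by linarith)) ?_ ?_
    · filter_upwards [self_mem_nhdsWithin] with s hs
      have hs : 0 < s := hs
      simp only [comb, hs.ne', if_false]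
      rw [← mul_rpow_one_div hs hb hv]
      have h1 := Real.rpow_nonneg hu (1 / s)
      have h2 := Real.rpow_nonneg hv (1 / s)
      exact Real.rpow_le_rpow (by positivity) (by nlinarith [mul_nonneg ha h1]) hs.le
    · filter_upwards [self_mem_nhdsWithin] with s hs
      have hs : 0 < s := hs
      simp only [comb, hs.ne', if_false]
      rw [← mul_rpow_one_div hs (add_nonneg ha hb) hv]
      have h1 := Real.rpow_nonneg hu (1 / s)
      have h2 := Real.rpow_nonneg hv (1 / s)
      have h3 : u ^ (1 / s) ≤ v ^ (1 / s) := Real.rpow_le_rpow hu huv (by positivity)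
      exact Real.rpow_le_rpow (by positivity)
        (by nlinarith [mul_le_mul_of_nonneg_left h3 ha]) hs.le

end LpBBL

end

namespace LpBBL

open Set Filter Topology
open scoped ENNReal Pointwise

/-! For fixed `lam` the hypothesis is a Borell–Brascamp–Lieb condition whose coefficients `a`, `b`
need not sum to one. Replacing `f` by `a ^ s * f (a⁻¹ • x)`, and `g` likewise, absorbs them
(`comb_integral_le`), so only `a = b = 1` is needed; the conclusion then carries the exponent `n +
s`. Choosing `lam` as in the equality case of Hölder's inequality turns that conclusion into the `p
/ (n + s)`-mean (`exists_comb_eq_mean`).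

The coefficient-free inequality is proved in `[0, ∞]`, where integrals over sections always make
sense. In dimension one, scaling both suprema to 1 allows Brunn–Minkowski on superlevel sets, and
Radon's inequality undoes the scaling. Fubini gives the induction on dimension (`BBL.prod`): each
integrated variable raises the exponent by one. -/

/-! ### Sumsets and superlevel sets on the line. -/

/-- One-dimensional Brunn–Minkowski inequality for compact sets. -/
theorem volume_add_le_of_isCompact {K L : Set ℝ} (hK : IsCompact K) (hL : IsCompact L)
    (hK0 : K.Nonempty) (hL0 : L.Nonempty) : volume K + volume L ≤ volume (K + L) := by
  have hk := hK.sSup_mem hK0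
  have hl := hL.sInf_mem hL0
  set k := sSup K
  set l := sInf L
  -- The translates of `K` by `min L` and of `L` by `max K` both lie in `K + L` and meet at most in
  -- `k + l`.
  have hsub : (l +ᵥ K) ∪ (k +ᵥ L) ⊆ K + L := by
    rintro x (⟨y, hy, rfl⟩ | ⟨y, hy, rfl⟩)
    · exact ⟨y, hy, l, hl, by simp [add_comm]⟩
    · exact ⟨k, hk, y, hy, by simp⟩
  have hint : AEDisjoint volume (l +ᵥ K) (k +ᵥ L) := by
    refine measure_mono_null (t := {k + l}) ?_ (by simp)
    rintro x ⟨⟨y, hy, rfl⟩, ⟨z, hz, hxz⟩⟩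
    have h1 : y ≤ k := le_csSup hK.bddAbove hy
    have h2 : l ≤ z := csInf_le hL.bddBelow hz
    simp only [vadd_eq_add] at hxz ⊢
    exact mem_singleton_iff.2 (by linarith)
  calc volume K + volume L = volume (l +ᵥ K) + volume (k +ᵥ L) := by simp [measure_vadd]
    _ = volume ((l +ᵥ K) ∪ (k +ᵥ L)) :=
      (measure_union₀ ((hL.vadd k).measurableSet.nullMeasurableSet) hint).symm
    _ ≤ _ := measure_mono hsub

/-- One-dimensional Brunn–Minkowski inequality. -/
theorem volume_add_le {A B C : Set ℝ} (hA : MeasurableSet A) (hB : MeasurableSet B)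
    (hA0 : A.Nonempty) (hB0 : B.Nonempty) (hC : A + B ⊆ C) : volume A + volume B ≤ volume C := by
  obtain ⟨a, ha⟩ := hA0
  obtain ⟨b, hb⟩ := hB0
  have key : ∀ S : Set ℝ, MeasurableSet S →
      volume S = ⨆ K : Set ℝ, ⨆ _ : K ⊆ S ∧ IsCompact K, volume K := fun S hS => by
    rw [hS.measure_eq_iSup_isCompact]
    simp only [iSup_and]
  rw [key A hA, key B hB]
  refine ENNReal.biSup_add_biSup_le' ⟨∅, empty_subset _, isCompact_empty⟩
    ⟨∅, empty_subset _, isCompact_empty⟩ fun K ⟨hKA, hK⟩ L ⟨hLB, hL⟩ => ?_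
  -- An approximating compact set may be empty; adjoining a point of `A` or `B` makes the compact
  -- case applicable.
  calc volume K + volume L ≤ volume (insert a K) + volume (insert b L) := by
        gcongr <;> exact subset_insert _ _
    _ ≤ volume (insert a K + insert b L) :=
      volume_add_le_of_isCompact (hK.insert a) (hL.insert b) (insert_nonempty _ _)
        (insert_nonempty _ _)
    _ ≤ volume C := measure_mono ((add_subset_add (insert_subset ha hKA)
        (insert_subset hb hLB)).trans hC)

theorem lintegral_eq_lintegral_meas_ofReal_lt {α : Type*} [MeasurableSpace α] (μ : Measure α)
    {f : α → ℝ≥0∞} (hf : Measurable f) (hf1 : ∀ x, f x ≠ ∞) :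
    ∫⁻ x, f x ∂μ = ∫⁻ t in Ioi (0 : ℝ), μ {x | ENNReal.ofReal t < f x} := by
  have := lintegral_eq_lintegral_meas_lt μ (f := fun x => (f x).toReal)
    (Eventually.of_forall fun x => ENNReal.toReal_nonneg) hf.ennreal_toReal.aemeasurable
  simp only [ENNReal.ofReal_toReal (hf1 _)] at this
  rw [this]
  refine setLIntegral_congr_fun measurableSet_Ioi fun t ht => ?_
  congr 1
  ext x
  exact (ENNReal.ofReal_lt_iff_lt_toReal (le_of_lt ht) (hf1 x)).symm

/-- Since both suprema are 1, the superlevel sets of `f` and `g` are nonempty at every level below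
1, so Brunn–Minkowski applies level by level; at levels from 1 on they are empty. The layer-cake
formula integrates the result. -/
theorem lintegral_add_le_of_iSup_eq_one {f g h : ℝ → ℝ≥0∞} (hf : Measurable f)
    (hg : Measurable g) (hh : Measurable h) (hf1 : ⨆ x, f x = 1) (hg1 : ⨆ x, g x = 1)
    (hfgh : ∀ x y v, v < f x → v < g y → v < h (x + y)) :
    (∫⁻ x, f x) + ∫⁻ x, g x ≤ ∫⁻ x, h x := by
  have hf' : ∀ x, f x ≤ 1 := fun x => hf1 ▸ le_iSup f x
  have hg' : ∀ x, g x ≤ 1 := fun x => hg1 ▸ le_iSup g x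
  -- Truncating `h` at 1 makes it finite, as the layer-cake formula requires, and leaves its
  -- superlevel sets below 1 unchanged.
  calc (∫⁻ x, f x) + ∫⁻ x, g x ≤ ∫⁻ x, min (h x) 1 := by
        rw [lintegral_eq_lintegral_meas_ofReal_lt _ hf fun x => ((hf' x).trans_lt (by simp)).ne,
          lintegral_eq_lintegral_meas_ofReal_lt _ hg fun x => ((hg' x).trans_lt (by simp)).ne,
          lintegral_eq_lintegral_meas_ofReal_lt _ (hh.min measurable_const)
            fun x => ((min_le_right _ _).trans_lt (by simp)).ne, ← lintegral_add_left]
        · refine lintegral_mono fun t => ?_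
          rcases lt_or_ge (ENNReal.ofReal t) 1 with ht | ht
          · refine volume_add_le (measurableSet_lt measurable_const hf)
              (measurableSet_lt measurable_const hg) ?_ ?_ ?_
            · rwa [← hf1, lt_iSup_iff] at ht
            · rwa [← hg1, lt_iSup_iff] at ht
            · rintro _ ⟨x, hx, y, hy, rfl⟩
              exact lt_min (hfgh x y _ hx hy) ht
          · have e1 : {x | ENNReal.ofReal t < f x} = ∅ :=
              eq_empty_of_forall_notMem fun x hx => absurd hx ((hf' x).trans ht).not_gt
            have e2 : {x | ENNReal.ofReal t < g x} = ∅ :=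
              eq_empty_of_forall_notMem fun x hx => absurd hx ((hg' x).trans ht).not_gt
            simp [e1, e2]
        · exact Antitone.measurable fun t u htu => measure_mono fun x hx =>
            (ENNReal.ofReal_le_ofReal htu).trans_lt hx
    _ ≤ _ := lintegral_mono fun x => min_le_left _ _

/-! ### Unweighted combinations in `[0, ∞]`. -/

/-- The combination `(u^{1/s} + v^{1/s})^s`, understood as `max u v` for `s = 0`. -/
noncomputable def ecomb (s : ℝ) (u v : ℝ≥0∞) : ℝ≥0∞ :=
  if s = 0 then max u v else (u ^ (1 / s) + v ^ (1 / s)) ^ s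

theorem ecomb_mono {s : ℝ} (hs : 0 ≤ s) {u v u' v' : ℝ≥0∞} (hu : u ≤ u') (hv : v ≤ v') :
    ecomb s u v ≤ ecomb s u' v' := by
  unfold ecomb
  split_ifs
  · exact max_le_max hu hv
  · gcongr

theorem ecomb_mul {s : ℝ} (hs : 0 ≤ s) (c u v : ℝ≥0∞) :
    ecomb s (c * u) (c * v) = c * ecomb s u v := by
  unfold ecomb
  split_ifs with h
  · exact (mul_max_of_nonneg u v zero_le).symm
  · have : 0 ≤ 1 / s := by positivity
    rw [ENNReal.mul_rpow_of_nonneg _ _ this, ENNReal.mul_rpow_of_nonneg _ _ this, ← mul_add,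
      ENNReal.mul_rpow_of_nonneg _ _ hs, ← ENNReal.rpow_mul, one_div_mul_cancel h,
      ENNReal.rpow_one]

theorem le_ecomb_left {s : ℝ} (hs : 0 ≤ s) (u v : ℝ≥0∞) : u ≤ ecomb s u v := by
  unfold ecomb
  split_ifs with h
  · exact le_max_left _ _
  · calc u = (u ^ (1 / s)) ^ s := by
          rw [← ENNReal.rpow_mul, one_div_mul_cancel h, ENNReal.rpow_one]
      _ ≤ _ := by gcongr; exact le_self_add

theorem ecomb_ne_top {s : ℝ} (hs : 0 ≤ s) {u v : ℝ≥0∞} (hu : u ≠ ∞) (hv : v ≠ ∞) :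
    ecomb s u v ≠ ∞ := by
  unfold ecomb
  split_ifs with h
  · exact (max_lt hu.lt_top hv.lt_top).ne
  · have : 0 ≤ 1 / s := by positivity
    exact ENNReal.rpow_ne_top_of_nonneg hs (ENNReal.add_ne_top.2
      ⟨ENNReal.rpow_ne_top_of_nonneg this hu, ENNReal.rpow_ne_top_of_nonneg this hv⟩)

theorem continuous_ecomb (s : ℝ) : Continuous fun q : ℝ≥0∞ × ℝ≥0∞ => ecomb s q.1 q.2 := by
  unfold ecomb
  split_ifs with h
  · exact continuous_fst.max continuous_snd
  · have h1 : Continuous fun q : ℝ≥0∞ × ℝ≥0∞ => q.1 ^ (1 / s) :=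
      ENNReal.continuous_rpow_const.comp continuous_fst
    have h2 : Continuous fun q : ℝ≥0∞ × ℝ≥0∞ => q.2 ^ (1 / s) :=
      ENNReal.continuous_rpow_const.comp continuous_snd
    exact ENNReal.continuous_rpow_const.comp (h1.add h2)

/-- A form of Radon's inequality. -/
theorem ecomb_one_add_le {s : ℝ} (hs : 0 ≤ s) {a b : ℝ≥0∞} (ha : a ≠ 0) (ha' : a ≠ ∞)
    (hb : b ≠ 0) (hb' : b ≠ ∞) (I J : ℝ≥0∞) :
    ecomb (1 + s) I J ≤ ecomb s a b * (I / a + J / b) := by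
  rcases hs.eq_or_lt with rfl | hs0
  · simp only [ecomb, add_zero, one_ne_zero, if_false, if_true, div_one, ENNReal.rpow_one, mul_add]
    gcongr
    · calc I = a * (I / a) := (ENNReal.mul_div_cancel ha ha').symm
        _ ≤ _ := by gcongr; exact le_max_left _ _
    · calc J = b * (J / b) := (ENNReal.mul_div_cancel hb hb').symm
        _ ≤ _ := by gcongr; exact le_max_right _ _
  have h1s : 0 < 1 + s := by positivity
  have key : ∀ (α σ I : ℝ≥0∞), α ≠ 0 → α ≠ ∞ → σ ≠ 0 → σ ≠ ∞ →
      (α / σ) * (I ^ (1 / (1 + s)) / (α / σ)) ^ (1 + s) = σ ^ s * (I / α ^ s) := by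
    intro α σ I h1 h2 h3 h4
    have hw : α / σ ≠ 0 := ENNReal.div_ne_zero.2 ⟨h1, h4⟩
    have hw' : α / σ ≠ ∞ := ENNReal.div_ne_top h2 h3
    rw [ENNReal.div_rpow_of_nonneg _ _ h1s.le, ← ENNReal.rpow_mul, one_div_mul_cancel h1s.ne',
      ENNReal.rpow_one, ENNReal.rpow_add _ _ hw hw', ENNReal.rpow_one, div_eq_mul_inv I,
      ENNReal.mul_inv (.inl hw) (.inl hw'), mul_left_comm I, ← mul_assoc,
      ENNReal.mul_inv_cancel hw hw', one_mul, ENNReal.div_rpow_of_nonneg _ _ hs,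
      ENNReal.inv_div (.inl (ENNReal.rpow_ne_top_of_nonneg hs h4))
        (.inl (ENNReal.rpow_pos (pos_iff_ne_zero.2 h3) h4).ne')]
    simp only [div_eq_mul_inv]
    ring
  have h1 : 0 ≤ 1 / s := by positivity
  have hα : a ^ (1 / s) ≠ 0 := (ENNReal.rpow_pos (pos_iff_ne_zero.2 ha) ha').ne'
  have hβ : b ^ (1 / s) ≠ 0 := (ENNReal.rpow_pos (pos_iff_ne_zero.2 hb) hb').ne'
  have hα' : a ^ (1 / s) ≠ ∞ := ENNReal.rpow_ne_top_of_nonneg h1 ha'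
  have hβ' : b ^ (1 / s) ≠ ∞ := ENNReal.rpow_ne_top_of_nonneg h1 hb'
  have ea : a = (a ^ (1 / s)) ^ s := by
    rw [← ENNReal.rpow_mul, one_div_mul_cancel hs0.ne', ENNReal.rpow_one]
  have eb : b = (b ^ (1 / s)) ^ s := by
    rw [← ENNReal.rpow_mul, one_div_mul_cancel hs0.ne', ENNReal.rpow_one]
  simp only [ecomb, hs0.ne', h1s.ne', if_false]
  conv_rhs => enter [2]; rw [ea, eb]
  generalize a ^ (1 / s) = α at *
  generalize b ^ (1 / s) = β at *
  have hσ : α + β ≠ 0 := by simp [hα]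
  have hσ' : α + β ≠ ∞ := ENNReal.add_ne_top.2 ⟨hα', hβ'⟩
  -- Convexity of `x ^ (1 + s)`, with weights proportional to `α = a ^ (1 / s)` and `β = b ^ (1 /
  -- s)`; each argument is divided by its weight so that the mean becomes `I ^ (1 / (1 + s)) + J ^
  -- (1 / (1 + s))`.
  have := ENNReal.rpow_arith_mean_le_arith_mean2_rpow (α / (α + β)) (β / (α + β))
    (I ^ (1 / (1 + s)) / (α / (α + β))) (J ^ (1 / (1 + s)) / (β / (α + β)))
    (by rw [← ENNReal.add_div, ENNReal.div_self hσ hσ']) (p := 1 + s) (by linarith)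
  rwa [key _ _ _ hα hα' hσ hσ', key _ _ _ hβ hβ' hσ hσ', ← mul_add,
    ENNReal.mul_div_cancel (ENNReal.div_ne_zero.2 ⟨hα, hσ'⟩) (ENNReal.div_ne_top hα' hσ),
    ENNReal.mul_div_cancel (ENNReal.div_ne_zero.2 ⟨hβ, hσ'⟩) (ENNReal.div_ne_top hβ' hσ)] at this

/-! ### The coefficient-free inequality, by induction on dimension. -/

/-- The Borell–Brascamp–Lieb inequality in `E`, of dimension `d`, for measurable functions with
values in `[0, ∞]` and all exponents `s ≥ 0`. -/
def BBL (E : Type*) [Add E] [MeasureSpace E] (d : ℝ) : Prop :=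
  ∀ s : ℝ, 0 ≤ s → ∀ f g h : E → ℝ≥0∞, Measurable f → Measurable g → Measurable h →
    (∀ x y, f x ≠ 0 → g y ≠ 0 → ecomb s (f x) (g y) ≤ h (x + y)) →
    ∫⁻ x, f x ≠ 0 → ∫⁻ x, g x ≠ 0 → ecomb (d + s) (∫⁻ x, f x) (∫⁻ x, g x) ≤ ∫⁻ x, h x

/-- Dividing `f`, `g` by their suprema `a`, `b` and `h` by `ecomb s a b` preserves the level-set
condition, by homogeneity of `ecomb`. Radon's inequality converts the resulting additive bound. -/
theorem ecomb_lintegral_le_of_iSup_ne_top {s : ℝ} (hs : 0 ≤ s) {f g h : ℝ → ℝ≥0∞}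
    (hf : Measurable f) (hg : Measurable g) (hh : Measurable h)
    (hf1 : ⨆ x, f x ≠ ∞) (hg1 : ⨆ x, g x ≠ ∞)
    (hfgh : ∀ x y, f x ≠ 0 → g y ≠ 0 → ecomb s (f x) (g y) ≤ h (x + y))
    (hf0 : ∫⁻ x, f x ≠ 0) (hg0 : ∫⁻ x, g x ≠ 0) :
    ecomb (1 + s) (∫⁻ x, f x) (∫⁻ x, g x) ≤ ∫⁻ x, h x := by
  have ha0 : ⨆ x, f x ≠ 0 := fun h0 => hf0 <| by
    rw [lintegral_eq_zero_iff hf]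
    exact Eventually.of_forall fun x => nonpos_iff_eq_zero.1 (h0 ▸ le_iSup f x)
  have hb0 : ⨆ x, g x ≠ 0 := fun h0 => hg0 <| by
    rw [lintegral_eq_zero_iff hg]
    exact Eventually.of_forall fun x => nonpos_iff_eq_zero.1 (h0 ▸ le_iSup g x)
  have hfa : ⨆ x, f x / ⨆ x, f x = 1 := by
    rw [← ENNReal.iSup_div, ENNReal.div_self ha0 hf1]
  have hgb : ⨆ x, g x / ⨆ x, g x = 1 := by
    rw [← ENNReal.iSup_div, ENNReal.div_self hb0 hg1]
  set a := ⨆ x, f x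
  set b := ⨆ x, g x
  set m := ecomb s a b with hm
  have hm0 : m ≠ 0 := fun h0 => ha0 (nonpos_iff_eq_zero.1 (h0 ▸ le_ecomb_left hs a b))
  have hm1 : m ≠ ∞ := ecomb_ne_top hs hf1 hg1
  have key : (∫⁻ x, f x / a) + ∫⁻ x, g x / b ≤ ∫⁻ x, h x / m := by
    refine lintegral_add_le_of_iSup_eq_one (hf.div_const a) (hg.div_const b) (hh.div_const m)
      hfa hgb fun x y v hx hy => ?_
    -- An intermediate level `w` yields the strict inequality for `h` and is nonzero even if `v =
    -- 0`.
    obtain ⟨w, hvw, hw⟩ := exists_between (lt_min hx hy)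
    refine hvw.trans_le ?_
    have hx' : w * a ≤ f x := (ENNReal.le_div_iff_mul_le (.inl ha0) (.inl hf1)).1
      (hw.le.trans (min_le_left _ _))
    have hy' : w * b ≤ g y := (ENNReal.le_div_iff_mul_le (.inl hb0) (.inl hg1)).1
      (hw.le.trans (min_le_right _ _))
    have hw0 : w ≠ 0 := (zero_le.trans_lt hvw).ne'
    rw [ENNReal.le_div_iff_mul_le (.inl hm0) (.inl hm1), hm, ← ecomb_mul hs]
    refine (ecomb_mono hs hx' hy').trans (hfgh x y ?_ ?_)
    · exact fun h0 => mul_ne_zero hw0 ha0 (nonpos_iff_eq_zero.1 (h0 ▸ hx'))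
    · exact fun h0 => mul_ne_zero hw0 hb0 (nonpos_iff_eq_zero.1 (h0 ▸ hy'))
  simp only [div_eq_mul_inv] at key
  rw [lintegral_mul_const _ hf, lintegral_mul_const _ hg, lintegral_mul_const _ hh] at key
  simp only [← div_eq_mul_inv] at key
  calc _ ≤ m * ((∫⁻ x, f x) / a + (∫⁻ x, g x) / b) :=
        ecomb_one_add_le hs ha0 hf1 hb0 hg1 _ _
    _ ≤ m * ((∫⁻ x, h x) / m) := by gcongr
    _ = _ := ENNReal.mul_div_cancel hm0 hm1

theorem tendsto_lintegral_min_natCast {α : Type*} [MeasurableSpace α] {μ : Measure α}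
    {f : α → ℝ≥0∞} (hf : Measurable f) :
    Tendsto (fun k : ℕ => ∫⁻ x, min (f x) k ∂μ) atTop (𝓝 (∫⁻ x, f x ∂μ)) := by
  refine lintegral_tendsto_of_tendsto_of_monotone
    (fun k => (hf.min measurable_const).aemeasurable) ?_ ?_
  · exact Eventually.of_forall fun x k l hkl => min_le_min le_rfl (by exact_mod_cast hkl)
  · refine Eventually.of_forall fun x => ?_
    have := (tendsto_const_nhds (x := f x)).min ENNReal.tendsto_nat_nhds_top
    simpa using this

/-- Unbounded functions are truncated at `k`; monotone convergence and continuity of `ecomb` allow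
`k → ∞`. -/
theorem bbl_real : BBL ℝ 1 := by
  intro s hs f g h hf hg hh hfgh hf0 hg0
  have tf := tendsto_lintegral_min_natCast (μ := volume) hf
  have tg := tendsto_lintegral_min_natCast (μ := volume) hg
  have t := ((continuous_ecomb (1 + s)).tendsto _).comp (tf.prodMk_nhds tg)
  refine le_of_tendsto t ?_
  have bdd : ∀ (u : ℝ → ℝ≥0∞) (k : ℕ), ⨆ x, min (u x) k ≠ ∞ := fun u k =>
    ((iSup_le fun x => min_le_right _ _).trans_lt (ENNReal.natCast_lt_top k)).ne
  filter_upwards [tf.eventually_ne hf0, tg.eventually_ne hg0] with k hk1 hk2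
  refine ecomb_lintegral_le_of_iSup_ne_top hs (hf.min measurable_const)
    (hg.min measurable_const) hh (bdd f k) (bdd g k) (fun x y hx hy => ?_) hk1 hk2
  refine (ecomb_mono hs (min_le_left _ _) (min_le_left _ _)).trans (hfgh x y ?_ ?_)
  · rintro h0; simp [h0] at hx
  · rintro h0; simp [h0] at hy

/-- The inequality in `E`, applied to sections, says that the marginals satisfy the one-dimensional
hypothesis with exponent `d + s`. -/
theorem BBL.prod {E : Type*} [Add E] [MeasureSpace E] [SFinite (volume : Measure E)] {d : ℝ}
    (hd : 0 ≤ d) (hE : BBL E d) : BBL (ℝ × E) (d + 1) := by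
  intro s hs f g h hf hg hh hfgh hf0 hg0
  rw [Measure.volume_eq_prod] at *
  rw [lintegral_prod _ hf.aemeasurable] at *
  rw [lintegral_prod _ hg.aemeasurable] at *
  rw [lintegral_prod _ hh.aemeasurable] at *
  rw [show d + 1 + s = 1 + (d + s) by ring]
  refine bbl_real (d + s) (by positivity) _ _ _ hf.lintegral_prod_right' hg.lintegral_prod_right'
    hh.lintegral_prod_right' (fun x y hx hy => ?_) hf0 hg0
  exact hE s hs _ _ _ (hf.comp measurable_prodMk_left) (hg.comp measurable_prodMk_left)
    (hh.comp measurable_prodMk_left) (fun x' y' => hfgh (x, x') (y, y')) hx hy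

theorem BBL.of_measurePreserving {E F : Type*} [Add E] [MeasureSpace E] [Add F] [MeasureSpace F]
    {d : ℝ} (hE : BBL E d) (e : E ≃ᵐ F) (he : MeasurePreserving e)
    (hadd : ∀ x y, e (x + y) = e x + e y) : BBL F d := by
  intro s hs f g h hf hg hh hfgh hf0 hg0
  rw [← he.lintegral_comp hf] at *
  rw [← he.lintegral_comp hg] at *
  rw [← he.lintegral_comp hh] at *
  refine hE s hs _ _ _ (hf.comp e.measurable) (hg.comp e.measurable) (hh.comp e.measurable)
    (fun x y hx hy => ?_) hf0 hg0
  rw [hadd]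
  exact hfgh _ _ hx hy

theorem bbl_pi (n : ℕ) : BBL (Fin n → ℝ) n := by
  induction n with
  | zero =>
    intro s hs f g h hf hg hh hfgh hf0 hg0
    have e : ∀ u : (Fin 0 → ℝ) → ℝ≥0∞, ∫⁻ x, u x = u 0 := fun u => by
      rw [volume_pi, Measure.pi_of_empty _ 0, lintegral_dirac]
    rw [e] at *
    rw [e] at *
    rw [e] at *
    simpa using hfgh 0 0 hf0 hg0
  | succ n ih =>
    have := BBL.prod n.cast_nonneg ih
    rw [Nat.cast_succ]
    exact this.of_measurePreserving (MeasurableEquiv.piFinSuccAbove (fun _ => ℝ) 0).symm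
      (volume_preserving_piFinSuccAbove (fun _ : Fin (n + 1) => ℝ) 0).symm fun x y => by
        apply (MeasurableEquiv.piFinSuccAbove (fun _ : Fin (n + 1) => ℝ) 0).injective
        simp
        rfl

theorem bbl_euclideanSpace (n : ℕ) : BBL (EuclideanSpace ℝ (Fin n)) n :=
  (bbl_pi n).of_measurePreserving (MeasurableEquiv.toLp 2 (Fin n → ℝ))
    (PiLp.volume_preserving_toLp (Fin n)) fun _ _ => rfl

/-! ### Integrable real functions and positive coefficients. -/

/-- The majorant must hold at every point, because the hypothesis on `h` is pointwise. It is set to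
`∞` on a measurable null set containing all points where `u` differs from its measurable
representative. -/
theorem exists_measurable_ge_lintegral_eq {α : Type*} [MeasurableSpace α] {μ : Measure α}
    {u : α → ℝ≥0∞} (hu : AEMeasurable u μ) :
    ∃ v, Measurable v ∧ u ≤ v ∧ ∫⁻ x, v x ∂μ = ∫⁻ x, u x ∂μ := by
  classical
  set N := toMeasurable μ {x | u x ≠ hu.mk u x}
  have hN : μ N = 0 := (measure_toMeasurable _).trans hu.ae_eq_mk
  refine ⟨N.piecewise (fun _ => ∞) (hu.mk u), measurable_const.piecewise
    (measurableSet_toMeasurable _ _) hu.measurable_mk, fun x => ?_, lintegral_congr_ae ?_⟩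
  · by_cases hx : x ∈ N
    · simp [hx]
    · rw [piecewise_eq_of_notMem _ _ _ hx]
      by_contra h
      exact hx (subset_toMeasurable _ _ fun e => h e.le)
  · filter_upwards [compl_mem_ae_iff.2 hN, hu.ae_eq_mk] with x hx hx'
    rw [piecewise_eq_of_notMem _ _ _ hx, hx']

theorem ofReal_comb {s u v : ℝ} (hs : 0 ≤ s) (hu : 0 ≤ u) (hv : 0 ≤ v) :
    ENNReal.ofReal (comb s 1 1 u v) = ecomb s (ENNReal.ofReal u) (ENNReal.ofReal v) := by
  unfold comb ecomb
  split_ifs with h h1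
  · exact ENNReal.ofReal_max u v
  · simp at h1
  · have h1 : 0 ≤ 1 / s := by positivity
    have h2 := Real.rpow_nonneg hu (1 / s)
    have h3 := Real.rpow_nonneg hv (1 / s)
    rw [one_mul, one_mul, ENNReal.ofReal_rpow_of_nonneg hu h1,
      ENNReal.ofReal_rpow_of_nonneg hv h1, ← ENNReal.ofReal_add h2 h3,
      ENNReal.ofReal_rpow_of_nonneg (add_nonneg h2 h3) hs]

/-- The coefficients of `comb` can be absorbed into its arguments. -/
theorem comb_rpow_mul {s a b u v : ℝ} (ha : 0 < a) (hb : 0 < b) (hu : 0 ≤ u)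
    (hv : 0 ≤ v) : comb s 1 1 (a ^ s * u) (b ^ s * v) = comb s a b u v := by
  unfold comb
  by_cases h : s = 0
  · simp [h, ha, hb]
  · rw [if_neg h, if_neg h, Real.mul_rpow (by positivity) hu, Real.mul_rpow (by positivity) hv,
      ← Real.rpow_mul ha.le, ← Real.rpow_mul hb.le, mul_one_div_cancel h, Real.rpow_one,
      Real.rpow_one, one_mul, one_mul]

theorem comb_integral_le_one {n : ℕ} {s : ℝ} (hs : 0 ≤ s) {f g h : EuclideanSpace ℝ (Fin n) → ℝ}
    (hf : ∀ x, 0 ≤ f x) (hg : ∀ x, 0 ≤ g x) (hh : ∀ x, 0 ≤ h x)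
    (hf_int : Integrable f) (hg_int : Integrable g) (hh_int : Integrable h)
    (hfgh : ∀ x ∈ Function.support f, ∀ y ∈ Function.support g,
      comb s 1 1 (f x) (g y) ≤ h (x + y))
    (hf0 : 0 < ∫ x, f x) (hg0 : 0 < ∫ x, g x) :
    comb (n + s) 1 1 (∫ x, f x) (∫ x, g x) ≤ ∫ x, h x := by
  rw [← ENNReal.ofReal_le_ofReal_iff (integral_nonneg hh),
    ofReal_comb (by positivity) hf0.le hg0.le]
  replace hf0 := (ENNReal.ofReal_pos.2 hf0).ne'
  replace hg0 := (ENNReal.ofReal_pos.2 hg0).ne'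
  rw [ofReal_integral_eq_lintegral_ofReal hf_int (Eventually.of_forall hf)] at *
  rw [ofReal_integral_eq_lintegral_ofReal hg_int (Eventually.of_forall hg)] at *
  rw [ofReal_integral_eq_lintegral_ofReal hh_int (Eventually.of_forall hh)]
  -- Measurable minorants of `f`, `g` and a majorant of `h` with the same integrals keep the
  -- pointwise hypothesis true.
  obtain ⟨F, hF, hFf, eF⟩ := exists_measurable_le_lintegral_eq volume fun x => ENNReal.ofReal (f x)
  obtain ⟨G, hG, hGg, eG⟩ := exists_measurable_le_lintegral_eq volume fun x => ENNReal.ofReal (g x)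
  obtain ⟨H, hH, hhH, eH⟩ := exists_measurable_ge_lintegral_eq hh_int.aemeasurable.ennreal_ofReal
  rw [eF, eG, ← eH]
  refine bbl_euclideanSpace n s hs F G H hF hG hH (fun x y hx hy => ?_) (eF ▸ hf0) (eG ▸ hg0)
  have hx' : 0 < f x := ENNReal.ofReal_pos.1 ((pos_iff_ne_zero.2 hx).trans_le (hFf x))
  have hy' : 0 < g y := ENNReal.ofReal_pos.1 ((pos_iff_ne_zero.2 hy).trans_le (hGg y))
  calc ecomb s (F x) (G y) ≤ ecomb s (ENNReal.ofReal (f x)) (ENNReal.ofReal (g y)) :=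
        ecomb_mono hs (hFf x) (hGg y)
    _ = ENNReal.ofReal (comb s 1 1 (f x) (g y)) := (ofReal_comb hs (hf x) (hg y)).symm
    _ ≤ ENNReal.ofReal (h (x + y)) :=
      ENNReal.ofReal_le_ofReal (hfgh x hx'.ne' y hy'.ne')
    _ ≤ H (x + y) := hhH _

/-- The Borell–Brascamp–Lieb inequality with arbitrary positive coefficients. -/
theorem comb_integral_le {n : ℕ} {s a b : ℝ} (hs : 0 ≤ s) (ha : 0 < a) (hb : 0 < b)
    {f g h : EuclideanSpace ℝ (Fin n) → ℝ}
    (hf : ∀ x, 0 ≤ f x) (hg : ∀ x, 0 ≤ g x) (hh : ∀ x, 0 ≤ h x)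
    (hf_int : Integrable f) (hg_int : Integrable g) (hh_int : Integrable h)
    (hfgh : ∀ x ∈ Function.support f, ∀ y ∈ Function.support g,
      comb s a b (f x) (g y) ≤ h (a • x + b • y))
    (hf0 : 0 < ∫ x, f x) (hg0 : 0 < ∫ x, g x) :
    comb (n + s) a b (∫ x, f x) (∫ x, g x) ≤ ∫ x, h x := by
  -- The exponent `n` is the Jacobian of the dilation; `s` comes from the prefactor.
  have scale : ∀ (c : ℝ) (u : EuclideanSpace ℝ (Fin n) → ℝ), 0 < c →
      ∫ x, c ^ s * u (c⁻¹ • x) = c ^ (n + s) * ∫ x, u x := fun c u hc => by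
    rw [integral_const_mul, Measure.integral_comp_inv_smul_of_nonneg volume u hc.le,
      finrank_euclideanSpace_fin, smul_eq_mul, Real.rpow_add hc, Real.rpow_natCast]
    ring
  have := hf0.le
  have := hg0.le
  rw [← comb_rpow_mul ha hb hf0.le hg0.le, ← scale a f ha, ← scale b g hb]
  refine comb_integral_le_one hs (fun x => mul_nonneg (by positivity) (hf _))
    (fun x => mul_nonneg (by positivity) (hg _)) hh
    ((hf_int.comp_smul (inv_ne_zero ha.ne')).const_mul _)
    ((hg_int.comp_smul (inv_ne_zero hb.ne')).const_mul _) hh_int (fun x hx y hy => ?_) ?_ ?_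
  · rw [comb_rpow_mul ha hb (hf _) (hg _)]
    have := hfgh _ (right_ne_zero_of_mul hx) _ (right_ne_zero_of_mul hy)
    rwa [smul_inv_smul₀ ha.ne', smul_inv_smul₀ hb.ne'] at this
  · rw [scale a f ha]; positivity
  · rw [scale b g hb]; positivity

/-! ### The optimal `lam`. -/

/-- The equality case of Hölder's inequality, for `τ X ^ p` a part of `S`. -/
theorem weight_mul {p τ X S : ℝ} (hp : 1 ≤ p) (hτ : 0 < τ) (hX : 0 < X) (hS : 0 < S) :
    weight p τ (τ * X ^ p / S) * X = τ * X ^ p * S ^ (1 / p - 1) := by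
  have hp0 : p ≠ 0 := by positivity
  have hq : (p - 1) / p = 1 - 1 / p := by field_simp
  have h1 : X = (X ^ p) ^ (1 / p) := by
    rw [← Real.rpow_mul hX.le, mul_one_div_cancel hp0, Real.rpow_one]
  have hY : 0 < X ^ p := by positivity
  conv_lhs => enter [2]; rw [h1]
  generalize X ^ p = Y at *
  unfold weight
  rw [hq, mul_right_comm, ← Real.mul_rpow hτ.le hY.le, Real.div_rpow (by positivity) hS.le,
    mul_div_assoc', ← Real.rpow_add (by positivity), add_sub_cancel, Real.rpow_one,
    ← neg_sub 1 (1 / p), Real.rpow_neg hS.le, div_eq_mul_inv]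

theorem weight_pos {p τ σ : ℝ} (hτ : 0 < τ) (hσ : 0 < σ) : 0 < weight p τ σ := by
  unfold weight; positivity

theorem weight_zero {p σ : ℝ} (hp : 1 ≤ p) : weight p 0 σ = 0 := by
  rw [weight, Real.zero_rpow (by positivity), zero_mul]

theorem weight_one {p : ℝ} : weight p 1 1 = 1 := by simp [weight]

/-- The `p / d`-mean is attained by one of the combinations with weights `weight`. -/
theorem exists_comb_eq_mean {p t d A B : ℝ} (hp : 1 ≤ p) (hd : 0 < d) (ht : t ∈ Ioo (0 : ℝ) 1)
    (hA : 0 < A) (hB : 0 < B) : ∃ lam ∈ Ioo (0 : ℝ) 1,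
      comb d (weight p (1 - t) (1 - lam)) (weight p t lam) A B = mean (p / d) t A B := by
  obtain ⟨h0, h1⟩ := ht
  have h1' : 0 < 1 - t := by linarith
  have hp0 : 0 < p := by positivity
  set X := A ^ (1 / d) with hX
  set Y := B ^ (1 / d) with hY
  have hX0 : 0 < X := by positivity
  have hY0 : 0 < Y := by positivity
  set S := (1 - t) * X ^ p + t * Y ^ p with hS
  have hP : 0 < (1 - t) * X ^ p := by positivity
  have hQ : 0 < t * Y ^ p := by positivity
  have hS0 : 0 < S := by positivity
  have e : 1 - t * Y ^ p / S = (1 - t) * X ^ p / S := by field_simp; rw [hS]; ring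
  -- With `lam` and `1 - lam` proportional to `t * Y ^ p` and `(1 - t) * X ^ p`, equality holds in
  -- Hölder's inequality and the weighted sum of `X` and `Y` equals `S * S ^ (1 / p - 1) = S ^ (1 /
  -- p)`.
  refine ⟨t * Y ^ p / S, ⟨by positivity, (div_lt_one hS0).2 (by linarith)⟩, ?_⟩
  rw [e, comb, if_neg hd.ne', weight_mul hp h1' hX0 hS0, weight_mul hp h0 hY0 hS0, ← add_mul,
    ← hS, mean, if_neg (mul_pos hA hB).ne', if_neg (div_pos hp0 hd).ne']
  have hXp : A ^ (p / d) = X ^ p := by rw [hX, ← Real.rpow_mul hA.le]; congr 1; ring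
  have hYp : B ^ (p / d) = Y ^ p := by rw [hY, ← Real.rpow_mul hB.le]; congr 1; ring
  rw [hXp, hYp, ← hS]
  conv_lhs => enter [1, 1]; rw [← Real.rpow_one S]
  rw [← Real.rpow_add hS0, ← Real.rpow_mul hS0.le]
  congr 1
  field_simp
  ring

theorem comb_one_zero {s u v : ℝ} (hu : 0 ≤ u) : comb s 1 0 u v = u := by
  unfold comb
  split_ifs <;> simp_all [← Real.rpow_mul]

theorem comb_zero_one {s u v : ℝ} (hv : 0 ≤ v) : comb s 0 1 u v = v := by
  rw [comb_comm, comb_one_zero hv]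

theorem mean_zero_left {α a b : ℝ} (hα : α ≠ 0) (ha : 0 < a) (hb : 0 < b) :
    mean α 0 a b = a := by
  simp [mean, ha.ne', hb.ne', hα, ← Real.rpow_mul ha.le]

theorem mean_one_left {α a b : ℝ} (hα : α ≠ 0) (ha : 0 < a) (hb : 0 < b) :
    mean α 1 a b = b := by
  simp [mean, ha.ne', hb.ne', hα, ← Real.rpow_mul hb.le]

theorem exists_mem_support_of_integral_pos {α : Type*} [MeasurableSpace α] {μ : Measure α}
    {f : α → ℝ} (hf : 0 < ∫ x, f x ∂μ) : (Function.support f).Nonempty := by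
  by_contra h
  rw [not_nonempty_iff_eq_empty, Function.support_eq_empty_iff] at h
  simp [h] at hf

end LpBBL

/-! ### The main theorem. -/

theorem theorem3p5 (n : ℕ) (hn : 1 ≤ n) (p s t : ℝ) (hp : 1 ≤ p) (hs : 0 ≤ s)
    (ht : t ∈ Set.Icc (0 : ℝ) 1)
    (f g h : EuclideanSpace ℝ (Fin n) → ℝ)
    (hf_nonneg : ∀ x, 0 ≤ f x) (hg_nonneg : ∀ x, 0 ≤ g x) (hh_nonneg : ∀ x, 0 ≤ h x)
    (hf_bdd : ∃ C, ∀ x, f x ≤ C) (hg_bdd : ∃ C, ∀ x, g x ≤ C) (hh_bdd : ∃ C, ∀ x, h x ≤ C)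
    (hf_int : Integrable f volume) (hg_int : Integrable g volume)
    (hh_int : Integrable h volume)
    (hfgh : ∀ x ∈ Function.support f, ∀ y ∈ Function.support g,
      ∀ lam ∈ Set.Icc (0 : ℝ) 1,
        LpBBL.comb s (LpBBL.weight p (1 - t) (1 - lam)) (LpBBL.weight p t lam) (f x) (g y) ≤
          h (LpBBL.weight p (1 - t) (1 - lam) • x + LpBBL.weight p t lam • y)) :
    LpBBL.mean (p / (n + s)) t (∫ x, f x) (∫ x, g x) ≤ ∫ x, h x := by
  rcases (integral_nonneg hf_nonneg : 0 ≤ ∫ x, f x).eq_or_lt with hf0 | hf0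
  · simpa [LpBBL.mean, ← hf0] using integral_nonneg hh_nonneg
  rcases (integral_nonneg hg_nonneg : 0 ≤ ∫ x, g x).eq_or_lt with hg0 | hg0
  · simpa [LpBBL.mean, ← hg0] using integral_nonneg hh_nonneg
  have hd : 0 < n + s := by
    have : (1 : ℝ) ≤ n := by exact_mod_cast hn
    linarith
  have hα : p / (n + s) ≠ 0 := by positivity
  -- At an endpoint one weight vanishes, so positive coefficients are unavailable. For `t = 0`, `lam
  -- = 0` the weights are 1 and 0, and any point of the support of `g` gives `f ≤ h`; `t = 1`, `lam
  -- = 1` is symmetric.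
  rcases ht.1.eq_or_lt with rfl | h0
  · rw [LpBBL.mean_zero_left hα hf0 hg0]
    refine integral_mono hf_int hh_int fun x => ?_
    by_cases hx : f x = 0
    · simpa [hx] using hh_nonneg x
    obtain ⟨y, hy⟩ := LpBBL.exists_mem_support_of_integral_pos hg0
    simpa [LpBBL.weight_zero hp, LpBBL.weight_one, LpBBL.comb_one_zero (hf_nonneg x)]
      using hfgh x hx y hy 0 (by simp)
  rcases ht.2.eq_or_lt with rfl | h1
  · rw [LpBBL.mean_one_left hα hf0 hg0]
    refine integral_mono hg_int hh_int fun y => ?_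
    by_cases hy : g y = 0
    · simpa [hy] using hh_nonneg y
    obtain ⟨x, hx⟩ := LpBBL.exists_mem_support_of_integral_pos hf0
    simpa [LpBBL.weight_zero hp, LpBBL.weight_one, LpBBL.comb_zero_one (hg_nonneg y)]
      using hfgh x hx y hy 1 (by simp)
  obtain ⟨lam, hlam, e⟩ := LpBBL.exists_comb_eq_mean hp hd ⟨h0, h1⟩ hf0 hg0
  rw [← e]
  exact LpBBL.comb_integral_le hs (LpBBL.weight_pos (by linarith) (by linarith [hlam.2]))
    (LpBBL.weight_pos h0 hlam.1) hf_nonneg hg_nonneg hh_nonneg hf_int hg_int hh_int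
    (fun x hx y hy => hfgh x hx y hy lam (Set.Ioo_subset_Icc_self hlam)) hf0 hg0
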